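/- Let $(X,\mathcal F,\mu)$ be a $\sigma$-finite measure space and $\mathcal A\subseteq\mathcal F$ a $\sigma$-subalgebra such that $\mu|_{\mathcal A}$ is $\sigma$-finite. Write $E$ for the conditional expectation with respect to $\mathcal A$, defined for non-negative measurable functions and for all measurable $h:X\to\mathbb C$ with $E(|h|)<\infty$ a.e. Let $w,u:X\to\mathbb C$ be measurable with $E(|w|)<\infty$ and $E(|u|)<\infty$ a.e. and $E(|u|^2)\in L^\infty$, and suppose that $T=M_wEM_u$, $Th=w\,E(uh)$, is a bounded operator on the complex Hilbert space $L^2(\mathcal F)$. Let $r(T)$ be the spectral radius of $T$ and, for $m\ge 1$, put $d_m=\frac{1}{1/m+r(T)}$ and $R_m=\big(\sum_{n\ge0}d_m^{2n}T^{*n}T^n\big)^{1/2}$. The spectral radius algebra $\mathcal B_T$ consists of all bounded operators $S$ on $L^2(\mathcal F)$ with $\sup_{m\ge 1}\|R_mSR_m^{-1}\|<\infty$. Put $$v_m=\frac{d_m^2E(|w|^2)}{1-d_m^2|E(uw)|^2},\qquad \alpha_m=\frac{v_m}{1+v_mE(|u|^2)},$$ where $v_m$ is given the value $0$ at points where $E(|w|^2)=\infty$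 (almost everywhere on this set $u=0$). Let $f,g\in L^2(\mathcal F)$ and let $f\otimes g$ be the operator $h\mapsto\langle h,g\rangle f$, with $\langle\cdot,\cdot\rangle$ linear in the first variable. Then $v_m^{1/2}E(uf)$ and $\alpha_m^{1/2}E(ug)$ are in $L^2(\mathcal F)$ for every $m\ge 1$, and $f\otimes g\in\mathcal B_T$ if and only if $$\sup_{m\ge1}\Big(-\|\alpha_m^{1/2}E(ug)\|^2\|f\|^2+\|v_m^{1/2}E(uf)\|^2\big(\|g\|^2-\|\alpha_m^{1/2}E(ug)\|^2\big)\Big)<\infty .$$ -/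

import Mathlib

open MeasureTheory

noncomputable section

namespace SpectralRadiusAlgebra

section Hilbert

variable {H : Type*} [NormedAddCommGroup H] [InnerProductSpace ℂ H] [CompleteSpace H]

/-- The numbers `d_m = 1 / (1/m + r(T))`, where `r(T)` is the spectral radius of `T`. -/
def d (T : H →L[ℂ] H) (m : ℕ+) : ℝ :=
  1 / (1 / (m : ℝ) + (spectralRadius ℂ T).toReal)

/-- `R_m = (∑ₙ d_m²ⁿ (T*)ⁿ Tⁿ)^(1/2)`, the series being taken in the operator norm. -/
def R (T : H →L[ℂ] H) (m : ℕ+) : H →L[ℂ] H :=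
  CFC.sqrt (∑' n : ℕ, (d T m) ^ (2 * n) • (ContinuousLinearMap.adjoint T ^ n * T ^ n))

/-- The spectral radius algebra `B_T` of all bounded `S` with `sup_m ‖R_m S R_m⁻¹‖ < ∞`. -/
def algebraB (T : H →L[ℂ] H) : Set (H →L[ℂ] H) :=
  {S | BddAbove (Set.range fun m : ℕ+ => ‖R T m * S * Ring.inverse (R T m)‖)}

end Hilbert

section CondExp

variable {X : Type*} (𝒜 : MeasurableSpace X) {ℱ : MeasurableSpace X} (μ : Measure X)

/-- `f ∈ D(E)`: `f` is measurable and `E(|f|)` is finite almost everywhere. -/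
def Conditionable (f : X → ℂ) : Prop :=
  AEStronglyMeasurable f μ ∧ ∀ᵐ x ∂μ, condLExp 𝒜 μ (fun y => ‖f y‖ₑ) x < ⊤

/-- `E(f)` for a conditionable, not necessarily integrable, real function: `E(f⁺) - E(f⁻)`. -/
def condReal (f : X → ℝ) (x : X) : ℝ :=
  (condLExp 𝒜 μ (fun y => ENNReal.ofReal (f y)) x).toReal
    - (condLExp 𝒜 μ (fun y => ENNReal.ofReal (-f y)) x).toReal

/-- `E(f)` for a conditionable complex function. -/
def condE (f : X → ℂ) (x : X) : ℂ :=
  (condReal 𝒜 μ (fun y => (f y).re) x : ℂ) + (condReal 𝒜 μ (fun y => (f y).im) x : ℂ) * Complex.I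

/-- `E(|f|²)`, with values in `[0, ∞]`. -/
def condSq (f : X → ℂ) : X → ENNReal :=
  condLExp 𝒜 μ (fun y => ‖f y‖ₑ ^ 2)

/-- `v = d² E(|w|²) / (1 - d² |E(uw)|²)`. -/
def v (w u : X → ℂ) (d : ℝ) (x : X) : ℝ :=
  d ^ 2 * (condSq 𝒜 μ w x).toReal / (1 - d ^ 2 * ‖condE 𝒜 μ (fun y => u y * w y) x‖ ^ 2)

/-- `α = v / (1 + v E(|u|²))`. -/
def α (w u : X → ℂ) (d : ℝ) (x : X) : ℝ :=
  v 𝒜 μ w u d x / (1 + v 𝒜 μ w u d x * (condSq 𝒜 μ u x).toReal)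

/-- The function `a^(1/2) E(uf)`, for a weight `a`. -/
def weighted (a : X → ℝ) (u f : X → ℂ) (x : X) : ℂ :=
  (Real.sqrt (a x) : ℂ) * condE 𝒜 μ (fun y => u y * f y) x

/-- The norm of a square integrable function in `L²`. -/
def norm2 (f : X → ℂ) : ℝ := (eLpNorm f 2 μ).toReal

end CondExp

end SpectralRadiusAlgebra

end

/-!
Since `T` multiplies by `w` after conditioning, `T ^ (n + 1) = E(uw) ^ n T`, and summing a geometric
series gives `R_m² = 1 + V*V` for `V h = v_m^(1/2) E(uh)`. Put `A h = α_m^(1/2) E(uh)`. The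
pointwise identity `(1 - α_m E(|u|²)) v_m = α_m` turns into `(1 + V*V)(1 - A*A) = 1`, so that
`R_m⁻² = 1 - A*A`. As `R_m (f ⊗ g) R_m⁻¹` is the rank one operator of `R_m f` and `R_m⁻¹ g`,

  `‖R_m (f ⊗ g) R_m⁻¹‖² = (‖f‖² + ‖V f‖²) (‖g‖² - ‖A g‖²)`,

which differs from the expression in the theorem by the constant `‖f‖² ‖g‖²`.

No integrability of `u w` is assumed: testing the boundedness of `T` on one `h` with `E(uh) ≠ 0`
wherever `u ≠ 0` shows that `u = 0` where `E(|w|²) = ∞`, and testing the convergence of the series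
`R_m²` on it shows that `d_m |E(uw)| < 1`.
-/

namespace SpectralRadiusAlgebra

section SpectralRadius

open Filter Topology

variable {A : Type*} [NormedRing A] [NormedAlgebra ℂ A] [CompleteSpace A]

theorem spectralRadius_ne_top (a : A) : spectralRadius ℂ a ≠ ⊤ :=
  ne_top_of_le_ne_top (by finiteness) (spectrum.spectralRadius_le_pow_nnnorm_pow_one_div ℂ a 0)

theorem eventually_norm_pow_le_pow_of_spectralRadius_lt (a : A) {ρ : ℝ}
    (hρ : (spectralRadius ℂ a).toReal < ρ) : ∀ᶠ n : ℕ in atTop, ‖a ^ n‖ ≤ ρ ^ n := by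
  have hρ₀ : 0 < ρ := ENNReal.toReal_nonneg.trans_lt hρ
  have hρ' : spectralRadius ℂ a < ENNReal.ofReal ρ :=
    (ENNReal.lt_ofReal_iff_toReal_lt (spectralRadius_ne_top a)).2 hρ
  filter_upwards [(spectrum.pow_norm_pow_one_div_tendsto_nhds_spectralRadius a).eventually_lt_const
    hρ', eventually_gt_atTop 0] with n hn hn₀
  have hroot : ‖a ^ n‖ ^ (1 / n : ℝ) ≤ ρ := ((ENNReal.ofReal_lt_ofReal_iff hρ₀).1 hn).le
  calc ‖a ^ n‖ = (‖a ^ n‖ ^ (1 / n : ℝ)) ^ n := by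
        rw [one_div, Real.rpow_inv_natCast_pow (norm_nonneg _) hn₀.ne']
    _ ≤ ρ ^ n := by gcongr

theorem summable_pow_mul_norm_pow_sq (a : A) {c : ℝ} (hc₀ : 0 < c)
    (hc : c * (spectralRadius ℂ a).toReal < 1) :
    Summable fun n : ℕ => c ^ (2 * n) * ‖a ^ n‖ ^ 2 := by
  obtain ⟨ρ, hrρ, hρc⟩ := exists_between ((lt_div_iff₀' hc₀).2 hc)
  have hρ₀ : 0 < ρ := ENNReal.toReal_nonneg.trans_lt hrρ
  have hcρ : c * ρ < 1 := (lt_div_iff₀' hc₀).1 hρc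
  have hgeom : Summable fun n : ℕ => ((c * ρ) ^ 2) ^ n :=
    summable_geometric_of_lt_one (by positivity) (pow_lt_one₀ (by positivity) hcρ two_ne_zero)
  refine hgeom.of_norm_bounded_eventually_nat ?_
  filter_upwards [eventually_norm_pow_le_pow_of_spectralRadius_lt a hrρ] with n hn
  calc ‖c ^ (2 * n) * ‖a ^ n‖ ^ 2‖ = c ^ (2 * n) * ‖a ^ n‖ ^ 2 :=
        Real.norm_of_nonneg (by positivity)
    _ ≤ c ^ (2 * n) * (ρ ^ n) ^ 2 := by gcongr
    _ = ((c * ρ) ^ 2) ^ n := by ring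

end SpectralRadius

section Hilbert

open ContinuousLinearMap InnerProductSpace
open scoped InnerProductSpace

variable {H : Type*} [NormedAddCommGroup H] [InnerProductSpace ℂ H]

theorem d_pos (T : H →L[ℂ] H) (m : ℕ+) : 0 < d T m := by
  have : (0 : ℝ) < m := by exact_mod_cast m.pos
  unfold d
  positivity

theorem d_mul_spectralRadius_lt_one (T : H →L[ℂ] H) (m : ℕ+) :
    d T m * (spectralRadius ℂ T).toReal < 1 := by
  have hm : (0 : ℝ) < 1 / m := one_div_pos.2 (by exact_mod_cast m.pos)
  rw [d, one_div_mul_eq_div, div_lt_one (by positivity)]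
  exact lt_add_of_pos_left _ hm

variable [CompleteSpace H]

theorem norm_mul_rankOne_mul (S S' : H →L[ℂ] H) (f g : H) :
    ‖S * rankOne ℂ f g * S'‖ = ‖S f‖ * ‖adjoint S' g‖ := by
  rw [← norm_rankOne (𝕜 := ℂ), ← rankOne_comp, ← comp_rankOne]
  rfl

theorem norm_sqrt_apply_sq {P : H →L[ℂ] H} (hP : 0 ≤ P) (h : H) :
    ‖CFC.sqrt P h‖ ^ 2 = RCLike.re ⟪h, P h⟫_ℂ := by
  have hadj : adjoint (CFC.sqrt P) = CFC.sqrt P := (CFC.sqrt_nonneg P).isSelfAdjoint.star_eq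
  rw [apply_norm_sq_eq_inner_adjoint_right, hadj]
  exact congrArg (fun S : H →L[ℂ] H => RCLike.re ⟪h, S h⟫_ℂ) (CFC.sqrt_mul_sqrt_self P)

theorem norm_sqrt_mul_rankOne_mul_inverse_sq {P Q : H →L[ℂ] H} (hP : 0 ≤ P) (hPQ : P * Q = 1)
    (f g : H) :
    ‖CFC.sqrt P * rankOne ℂ f g * Ring.inverse (CFC.sqrt P)‖ ^ 2
      = RCLike.re ⟪f, P f⟫_ℂ * RCLike.re ⟪g, Q g⟫_ℂ := by
  have hQP : star Q * P = 1 := by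
    rw [← star_one (H →L[ℂ] H), ← hPQ, star_mul, hP.isSelfAdjoint.star_eq]
  have hunit : IsUnit (CFC.sqrt P) :=
    (CFC.isUnit_sqrt_iff P).2 (isUnit_iff_exists.2 ⟨Q, hPQ, left_inv_eq_right_inv hQP hPQ ▸ hQP⟩)
  have hsa : star (CFC.sqrt P) = CFC.sqrt P := (CFC.sqrt_nonneg P).isSelfAdjoint.star_eq
  have hinv : star (Ring.inverse (CFC.sqrt P)) = CFC.sqrt P * Q := by
    refine left_inv_eq_right_inv (a := CFC.sqrt P) ?_ ?_
    · nth_rw 2 [← hsa]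
      rw [← star_mul, Ring.mul_inverse_cancel _ hunit, star_one]
    · rw [← mul_assoc, CFC.sqrt_mul_sqrt_self P, hPQ]
  have hPQg : P (Q g) = g := DFunLike.congr_fun hPQ g
  have hinv_apply : adjoint (Ring.inverse (CFC.sqrt P)) g = CFC.sqrt P (Q g) :=
    DFunLike.congr_fun hinv g
  rw [norm_mul_rankOne_mul, mul_pow, hinv_apply, norm_sqrt_apply_sq hP, norm_sqrt_apply_sq hP, hPQg,
    inner_re_symm (Q g)]

theorem norm_sqrt_one_add_mul_rankOne_mul_inverse_sq {V A : H →L[ℂ] H}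
    (hVA : (1 + adjoint V * V) * (1 - adjoint A * A) = 1) (f g : H) :
    ‖CFC.sqrt (1 + adjoint V * V) * rankOne ℂ f g * Ring.inverse (CFC.sqrt (1 + adjoint V * V))‖ ^ 2
      = (‖f‖ ^ 2 + ‖V f‖ ^ 2) * (‖g‖ ^ 2 - ‖A g‖ ^ 2) := by
  have hpos : 0 ≤ 1 + adjoint V * V := add_nonneg zero_le_one (star_mul_self_nonneg V)
  rw [norm_sqrt_mul_rankOne_mul_inverse_sq hpos hVA, add_apply, sub_apply, inner_add_right,
    inner_sub_right, map_add, map_sub, apply_norm_sq_eq_inner_adjoint_right V,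
    apply_norm_sq_eq_inner_adjoint_right A, ← inner_self_eq_norm_sq (𝕜 := ℂ) f,
    ← inner_self_eq_norm_sq (𝕜 := ℂ) g]
  rfl

/-- The series `∑ₙ c²ⁿ (T*)ⁿ Tⁿ`, whose square root for `c = d_m` is `R_m`. It converges in operator
norm for `c r(T) < 1`. -/
noncomputable def powerGram (T : H →L[ℂ] H) (c : ℝ) : H →L[ℂ] H :=
  ∑' n : ℕ, c ^ (2 * n) • (adjoint T ^ n * T ^ n)

theorem hasSum_powerGram (T : H →L[ℂ] H) {c : ℝ} (hc₀ : 0 < c)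
    (hc : c * (spectralRadius ℂ T).toReal < 1) :
    HasSum (fun n : ℕ => c ^ (2 * n) • (adjoint T ^ n * T ^ n)) (powerGram T c) := by
  refine (Summable.of_norm_bounded (summable_pow_mul_norm_pow_sq T hc₀ hc) fun n => ?_).hasSum
  rw [norm_smul, Real.norm_of_nonneg (by positivity), show adjoint T ^ n = star (T ^ n) from
    (star_pow T n).symm, CStarRing.norm_star_mul_self, sq]

theorem hasSum_norm_pow_succ_apply_sq (T : H →L[ℂ] H) {c : ℝ} (hc₀ : 0 < c)
    (hc : c * (spectralRadius ℂ T).toReal < 1) (h : H) :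
    HasSum (fun n : ℕ => c ^ (2 * (n + 1)) * ‖(T ^ (n + 1)) h‖ ^ 2)
      (RCLike.re ⟪h, (powerGram T c - 1) h⟫_ℂ) := by
  have hterm (n : ℕ) : RCLike.re ⟪h, (c ^ (2 * n) • (adjoint T ^ n * T ^ n)) h⟫_ℂ
      = c ^ (2 * n) * ‖(T ^ n) h‖ ^ 2 := by
    rw [show adjoint T ^ n = adjoint (T ^ n) from (star_pow T n).symm, smul_apply,
      inner_smul_right_eq_smul, RCLike.smul_re, apply_norm_sq_eq_inner_adjoint_right]
    rfl
  have hsum := ((hasSum_powerGram T hc₀ hc).mapL (apply ℂ H h)).mapL (innerSL ℂ h)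
  have hshift := (hasSum_nat_add_iff' 1).2 (RCLike.hasSum_re ℂ hsum)
  simp only [apply_apply, innerSL_apply_apply, hterm, Finset.sum_range_one] at hshift
  have hval : RCLike.re ⟪h, (powerGram T c - 1) h⟫_ℂ
      = RCLike.re ⟪h, powerGram T c h⟫_ℂ - c ^ (2 * 0) * ‖(T ^ 0) h‖ ^ 2 := by
    rw [sub_apply, inner_sub_right, map_sub, one_apply_eq_self, inner_self_eq_norm_sq]
    simp
  rw [hval]
  exact hshift

theorem eq_adjoint_mul_self_of_re_inner {S V : H →L[ℂ] H} (hS : IsSelfAdjoint S)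
    (hV : ∀ h, ‖V h‖ ^ 2 = RCLike.re ⟪h, S h⟫_ℂ) : S = adjoint V * V := by
  refine coe_injective ((ext_inner_map _ _).1 fun h => ?_)
  have hreal : ⟪S h, h⟫_ℂ = (RCLike.re ⟪h, S h⟫_ℂ : ℝ) := by
    rw [inner_re_symm]
    exact (hS.isSymmetric.coe_re_inner_apply_self h).symm
  calc ⟪S h, h⟫_ℂ = ((‖V h‖ ^ 2 : ℝ) : ℂ) := by rw [hreal, hV]
    _ = ⟪(adjoint V * V) h, h⟫_ℂ := by
      change _ = ⟪adjoint V (V h), h⟫_ℂ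
      rw [adjoint_inner_left, inner_self_eq_norm_sq_to_K]
      push_cast
      rfl

theorem isSelfAdjoint_powerGram (T : H →L[ℂ] H) (c : ℝ) : IsSelfAdjoint (powerGram T c) := by
  rw [isSelfAdjoint_iff, powerGram, tsum_star]
  refine tsum_congr fun n => ?_
  rw [show adjoint T ^ n = star (T ^ n) from (star_pow T n).symm, star_smul, star_mul, star_star,
    star_trivial]

theorem norm_R_mul_rankOne_mul_inverse_sq_of_powerGram_eq (T : H →L[ℂ] H) (m : ℕ+)
    {V A : H →L[ℂ] H} (hgram : powerGram T (d T m) = 1 + adjoint V * V)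
    (hVA : (1 + adjoint V * V) * (1 - adjoint A * A) = 1) (f g : H) :
    ‖R T m * rankOne ℂ f g * Ring.inverse (R T m)‖ ^ 2
      = (‖f‖ ^ 2 + ‖V f‖ ^ 2) * (‖g‖ ^ 2 - ‖A g‖ ^ 2) := by
  rw [← norm_sqrt_one_add_mul_rankOne_mul_inverse_sq hVA, ← hgram]
  rfl

end Hilbert

section NonnegCondExp

open scoped ENNReal

variable {X : Type*} {𝒜 ℱ : MeasurableSpace X} (h𝒜 : 𝒜 ≤ ℱ) {μ : Measure[ℱ] X}
  [SigmaFinite (μ.trim h𝒜)]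

include h𝒜

theorem lintegral_mul_condLExp {k f : X → ℝ≥0∞} (hk : Measurable[𝒜] k) (hf : AEMeasurable f μ) :
    ∫⁻ x, k x * condLExp 𝒜 μ f x ∂μ = ∫⁻ x, k x * f x ∂μ := by
  have lintegral_mul_eq_trim (g : X → ℝ≥0∞) (hg : AEMeasurable g μ) :
      ∫⁻ x, k x * g x ∂μ = ∫⁻ x, k x ∂((μ.withDensity g).trim h𝒜) := by
    rw [lintegral_trim h𝒜 hk, lintegral_withDensity_eq_lintegral_mul₀ hg
      (hk.mono h𝒜 le_rfl).aemeasurable]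
    simp only [Pi.mul_apply, mul_comm]
  have htrim : (μ.withDensity (condLExp 𝒜 μ f)).trim h𝒜 = (μ.withDensity f).trim h𝒜 := by
    refine @Measure.ext _ 𝒜 _ _ fun s hs => ?_
    rw [trim_measurableSet_eq h𝒜 hs, trim_measurableSet_eq h𝒜 hs, withDensity_apply _ (h𝒜 s hs),
      withDensity_apply _ (h𝒜 s hs), setLIntegral_condLExp h𝒜 μ f hs]
  rw [lintegral_mul_eq_trim _ (measurable_condLExp' 𝒜 μ f).aemeasurable,
    lintegral_mul_eq_trim _ hf, htrim]

theorem condLExp_mul {k f : X → ℝ≥0∞} (hk : Measurable[𝒜] k) (hf : AEMeasurable f μ) :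
    condLExp 𝒜 μ (fun x => k x * f x) =ᵐ[μ] fun x => k x * condLExp 𝒜 μ f x := by
  refine (ae_eq_condLExp h𝒜 μ _ (hk.mul (measurable_condLExp 𝒜 μ f)) fun s hs => ?_).symm
  rw [← lintegral_indicator (h𝒜 s hs), ← lintegral_indicator (h𝒜 s hs)]
  simpa only [← Set.indicator_mul_left, Pi.mul_def] using
    lintegral_mul_condLExp h𝒜 (hk.indicator hs) hf

theorem ae_eq_zero_of_condLExp_eq_zero {f : X → ℝ≥0∞} (hf : AEMeasurable f μ) :
    ∀ᵐ x ∂μ, condLExp 𝒜 μ f x = 0 → f x = 0 := by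
  have hs : MeasurableSet[𝒜] {x | condLExp 𝒜 μ f x = 0} :=
    measurable_condLExp 𝒜 μ f (measurableSet_singleton 0)
  have hint : ∫⁻ x in {x | condLExp 𝒜 μ f x = 0}, f x ∂μ = 0 := by
    rw [← setLIntegral_condLExp h𝒜 μ f hs, setLIntegral_eq_zero_iff (h𝒜 _ hs)
      (measurable_condLExp' 𝒜 μ f)]
    exact .of_forall fun x hx => hx
  rw [lintegral_eq_zero_iff' hf.restrict] at hint
  exact (ae_restrict_iff' (h𝒜 _ hs)).1 hint

theorem exists_pos_lintegral_mul_lt_top {f : X → ℝ≥0∞} (hf : AEMeasurable f μ)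
    (hfin : ∀ᵐ x ∂μ, condLExp 𝒜 μ f x < ∞) :
    ∃ ψ : X → ℝ, Measurable[𝒜] ψ ∧ (∀ x, 0 < ψ x) ∧
      ∫⁻ x, ENNReal.ofReal (ψ x) * f x ∂μ < ∞ := by
  obtain ⟨p, hp₀, hp, hp_int⟩ :=
    @exists_pos_lintegral_lt_of_sigmaFinite X 𝒜 (μ.trim h𝒜) _ 1 one_ne_zero
  rw [lintegral_trim h𝒜 hp.coe_nnreal_ennreal] at hp_int
  have hψ : Measurable[𝒜] fun x => (p x : ℝ) / (1 + (condLExp 𝒜 μ f x).toReal) :=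
    hp.coe_nnreal_real.div (measurable_const.add (measurable_condLExp 𝒜 μ f).ennreal_toReal)
  refine ⟨_, hψ, fun x => ?_, ?_⟩
  · have := hp₀ x
    positivity
  rw [← lintegral_mul_condLExp h𝒜 hψ.ennreal_ofReal hf]
  refine (lintegral_mono_ae ?_).trans_lt (hp_int.trans ENNReal.one_lt_top)
  filter_upwards [hfin] with x hx
  rw [← ENNReal.ofReal_toReal hx.ne, ENNReal.toReal_ofReal ENNReal.toReal_nonneg,
    ← ENNReal.ofReal_mul (by positivity), ← ENNReal.ofReal_coe_nnreal]
  refine ENNReal.ofReal_le_ofReal ?_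
  rw [div_mul_eq_mul_div, div_le_iff₀ (by positivity)]
  gcongr
  linarith

end NonnegCondExp

section SquareIntegrable

open scoped ENNReal

variable {X : Type*} {𝒜 ℱ : MeasurableSpace X} {μ : Measure[ℱ] X}

theorem ofReal_norm_sq {E : Type*} [SeminormedAddGroup E] (z : E) :
    ENNReal.ofReal (‖z‖ ^ 2) = ‖z‖ₑ ^ 2 := by
  rw [ENNReal.ofReal_pow (norm_nonneg _), ofReal_norm]

theorem eLpNorm_two_sq (f : X → ℂ) : eLpNorm f 2 μ ^ 2 = ∫⁻ x, ‖f x‖ₑ ^ 2 ∂μ := by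
  simpa using eLpNorm_nnreal_pow_eq_lintegral (μ := μ) (f := f) (p := 2) two_ne_zero

theorem memLp_two_iff_lintegral_lt_top {f : X → ℂ} (hf : AEStronglyMeasurable f μ) :
    MemLp f 2 μ ↔ ∫⁻ x, ‖f x‖ₑ ^ 2 ∂μ < ∞ := by
  rw [MemLp, and_iff_right hf, ← eLpNorm_two_sq, ENNReal.pow_lt_top_iff]
  simp

theorem ofReal_norm_sq_eq_lintegral (f : Lp ℂ 2 μ) :
    ENNReal.ofReal (‖f‖ ^ 2) = ∫⁻ x, ‖f x‖ₑ ^ 2 ∂μ := by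
  rw [← eLpNorm_two_sq, ofReal_norm_sq, Lp.enorm_def]

theorem condSq_lt_top_of_memLp {f : X → ℂ} (hf : MemLp f 2 μ) :
    ∀ᵐ x ∂μ, condSq 𝒜 μ f x < ∞ :=
  condLExp_lt_top ((memLp_two_iff_lintegral_lt_top hf.1).1 hf).ne

end SquareIntegrable

section ComplexCondExp

open scoped ENNReal ComplexConjugate

variable {X : Type*} {𝒜 ℱ : MeasurableSpace X} {μ : Measure[ℱ] X}

theorem measurable_condReal (f : X → ℝ) : Measurable[𝒜] (condReal 𝒜 μ f) :=
  (measurable_condLExp 𝒜 μ _).ennreal_toReal.sub (measurable_condLExp 𝒜 μ _).ennreal_toReal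

theorem measurable_condE (f : X → ℂ) : Measurable[𝒜] (condE 𝒜 μ f) :=
  (Complex.measurable_ofReal.comp (measurable_condReal _)).add
    ((Complex.measurable_ofReal.comp (measurable_condReal _)).mul_const _)

theorem measurable_condSq (f : X → ℂ) : Measurable[𝒜] (condSq 𝒜 μ f) :=
  measurable_condLExp 𝒜 μ _

theorem condReal_congr {f g : X → ℝ} (h : f =ᵐ[μ] g) : condReal 𝒜 μ f =ᵐ[μ] condReal 𝒜 μ g := by
  filter_upwards [condLExp_congr_ae (mΩ := 𝒜) (h.fun_comp ENNReal.ofReal),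
    condLExp_congr_ae (mΩ := 𝒜) (h.neg.fun_comp ENNReal.ofReal)] with x hpos hneg
  exact congrArg₂ (fun a b => a.toReal - b.toReal) hpos hneg

theorem condE_congr {f g : X → ℂ} (h : f =ᵐ[μ] g) : condE 𝒜 μ f =ᵐ[μ] condE 𝒜 μ g := by
  filter_upwards [condReal_congr (𝒜 := 𝒜) (h.fun_comp Complex.re),
    condReal_congr (𝒜 := 𝒜) (h.fun_comp Complex.im)] with x hre him
  exact congrArg₂ (fun a b : ℝ => (a + b * Complex.I : ℂ)) hre him

theorem condE_of_nonneg {f : X → ℝ} (hf : ∀ x, 0 ≤ f x) (x : X) :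
    condE 𝒜 μ (fun y => (f y : ℂ)) x
      = ((condLExp 𝒜 μ (fun y => ENNReal.ofReal (f y)) x).toReal : ℂ) := by
  have hzero : condLExp 𝒜 μ (fun _ => (0 : ℝ≥0∞)) = 0 := condLExp_zero μ
  simp [condE, condReal, ENNReal.ofReal_of_nonpos (neg_nonpos.2 (hf _)), hzero]

theorem condE_norm_sq (f : X → ℂ) (x : X) :
    condE 𝒜 μ (fun y => ((‖f y‖ ^ 2 : ℝ) : ℂ)) x = ((condSq 𝒜 μ f x).toReal : ℂ) := by
  simp only [condE_of_nonneg fun y => sq_nonneg ‖f y‖, ofReal_norm_sq, condSq]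

theorem condReal_of_integrable {f : X → ℝ} (hf : Integrable f μ) :
    condReal 𝒜 μ f =ᵐ[μ] μ[f | 𝒜] := by
  have lintegral_ofReal_ne_top {g : X → ℝ} (hg : Integrable g μ) :
      ∫⁻ x, ENNReal.ofReal (g x) ∂μ ≠ ∞ :=
    ((lintegral_mono fun x => Real.ofReal_le_enorm (g x)).trans_lt hg.2).ne
  have hsub : (fun x => (Real.toNNReal (f x) : ℝ)) - (fun x => (Real.toNNReal (-f x) : ℝ)) = f := by
    ext x
    simp only [Pi.sub_apply, Real.coe_toNNReal', max_zero_sub_max_neg_zero_eq_self]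
  have hcond := condExp_sub (μ := μ) hf.real_toNNReal hf.neg.real_toNNReal 𝒜
  simp only [Pi.neg_apply, hsub] at hcond
  filter_upwards [toReal_condLExp 𝒜 hf.aemeasurable.ennreal_ofReal (lintegral_ofReal_ne_top hf),
    toReal_condLExp 𝒜 hf.neg.aemeasurable.ennreal_ofReal (lintegral_ofReal_ne_top hf.neg), hcond]
    with x hpos hneg hx
  rw [hx, Pi.sub_apply]
  exact congrArg₂ _ hpos hneg

theorem condE_of_integrable {f : X → ℂ} (hf : Integrable f μ) :
    condE 𝒜 μ f =ᵐ[μ] μ[f | 𝒜] := by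
  filter_upwards [condReal_of_integrable (𝒜 := 𝒜) hf.re, condReal_of_integrable (𝒜 := 𝒜) hf.im,
    Complex.reCLM.comp_condExp_comm hf (m := 𝒜), Complex.imCLM.comp_condExp_comm hf (m := 𝒜)]
    with x hre him hreCLM himCLM
  refine Complex.ext ?_ ?_
  · simpa [condE] using hre.trans hreCLM.symm
  · simpa [condE] using him.trans himCLM.symm

theorem Conditionable.of_enorm_le {f : X → ℂ} {g : X → ℝ≥0∞} (hf : AEStronglyMeasurable f μ)
    (hfg : ∀ᵐ x ∂μ, ‖f x‖ₑ ≤ g x) (hg : ∀ᵐ x ∂μ, condLExp 𝒜 μ g x < ∞) :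
    Conditionable 𝒜 μ f := by
  refine ⟨hf, ?_⟩
  filter_upwards [condLExp_mono (mΩ := 𝒜) hfg, hg] with x hle hlt using hle.trans_lt hlt

theorem conditionable_norm_sq {f : X → ℂ} (hf : AEStronglyMeasurable f μ)
    (hfin : ∀ᵐ x ∂μ, condSq 𝒜 μ f x < ∞) :
    Conditionable 𝒜 μ fun y => ((‖f y‖ ^ 2 : ℝ) : ℂ) := by
  refine .of_enorm_le (g := fun y => ‖f y‖ₑ ^ 2)
    (Complex.continuous_ofReal.comp_aestronglyMeasurable (hf.norm.pow 2)) (.of_forall fun x => ?_)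
    hfin
  rw [← ofReal_norm, Complex.norm_of_nonneg (by positivity), ofReal_norm_sq]

theorem enorm_mul_le_sq_add_sq (z z' : ℂ) : ‖z * z'‖ₑ ≤ ‖z‖ₑ ^ 2 + ‖z'‖ₑ ^ 2 := by
  rw [enorm_mul, sq, sq]
  rcases le_total ‖z‖ₑ ‖z'‖ₑ with h | h
  · exact le_add_left (by gcongr)
  · exact le_add_right (by gcongr)

theorem conditionable_mul {f g : X → ℂ} (hf : AEStronglyMeasurable f μ)
    (hg : AEStronglyMeasurable g μ) (hf_fin : ∀ᵐ x ∂μ, condSq 𝒜 μ f x < ∞)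
    (hg_fin : ∀ᵐ x ∂μ, condSq 𝒜 μ g x < ∞) : Conditionable 𝒜 μ fun y => f y * g y := by
  refine .of_enorm_le (g := (fun y => ‖f y‖ₑ ^ 2) + fun y => ‖g y‖ₑ ^ 2) (hf.mul hg)
    (.of_forall fun x => enorm_mul_le_sq_add_sq _ _) ?_
  filter_upwards [condLExp_add_left (mΩ := 𝒜) (fun y => ‖g y‖ₑ ^ 2) (hf.enorm.pow_const 2), hf_fin,
    hg_fin] with x hadd hfx hgx
  rw [hadd]
  exact ENNReal.add_lt_top.2 ⟨hfx, hgx⟩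

variable (h𝒜 : 𝒜 ≤ ℱ) [SigmaFinite (μ.trim h𝒜)]

include h𝒜

theorem condReal_mul_of_nonneg {ψ f : X → ℝ} (hψ : Measurable[𝒜] ψ) (hψ₀ : ∀ x, 0 ≤ ψ x)
    (hf : AEMeasurable f μ) :
    condReal 𝒜 μ (fun x => ψ x * f x) =ᵐ[μ] fun x => ψ x * condReal 𝒜 μ f x := by
  filter_upwards [condLExp_mul h𝒜 hψ.ennreal_ofReal hf.ennreal_ofReal,
    condLExp_mul h𝒜 hψ.ennreal_ofReal hf.neg.ennreal_ofReal] with x hpos hneg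
  simp only [Pi.neg_apply] at hneg
  simp only [condReal, ← mul_neg, ENNReal.ofReal_mul (hψ₀ _), hpos, hneg, ENNReal.toReal_mul,
    ENNReal.toReal_ofReal (hψ₀ x), mul_sub]

theorem condE_mul_of_nonneg {ψ : X → ℝ} {f : X → ℂ} (hψ : Measurable[𝒜] ψ) (hψ₀ : ∀ x, 0 ≤ ψ x)
    (hf : AEStronglyMeasurable f μ) :
    condE 𝒜 μ (fun x => ψ x * f x) =ᵐ[μ] fun x => ψ x * condE 𝒜 μ f x := by
  filter_upwards [condReal_mul_of_nonneg h𝒜 hψ hψ₀ hf.aemeasurable.re,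
    condReal_mul_of_nonneg h𝒜 hψ hψ₀ hf.aemeasurable.im] with x hre him
  simp only [RCLike.re_eq_complex_re, RCLike.im_eq_complex_im] at hre him
  simp only [condE, Complex.re_ofReal_mul, Complex.im_ofReal_mul, hre, him]
  push_cast
  ring

namespace Conditionable

theorem exists_pos_integrable_mul {f g : X → ℂ} (hf : Conditionable 𝒜 μ f)
    (hg : Conditionable 𝒜 μ g) :
    ∃ ψ : X → ℝ, Measurable[𝒜] ψ ∧ (∀ x, 0 < ψ x) ∧
      Integrable (fun x => ψ x * f x) μ ∧ Integrable (fun x => ψ x * g x) μ := by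
  have hadd : ∀ᵐ x ∂μ, condLExp 𝒜 μ ((fun y => ‖f y‖ₑ) + fun y => ‖g y‖ₑ) x < ∞ := by
    filter_upwards [condLExp_add_left (mΩ := 𝒜) (fun y => ‖g y‖ₑ) hf.1.enorm, hf.2, hg.2]
      with x hx hfx hgx
    rw [hx]
    exact ENNReal.add_lt_top.2 ⟨hfx, hgx⟩
  obtain ⟨ψ, hψ, hψ₀, hint⟩ :=
    exists_pos_lintegral_mul_lt_top h𝒜 (hf.1.enorm.add hg.1.enorm) hadd
  have integrable_mul {k : X → ℂ} (hk : AEStronglyMeasurable k μ)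
      (hk_le : ∀ x, ‖k x‖ₑ ≤ ‖f x‖ₑ + ‖g x‖ₑ) : Integrable (fun x => ψ x * k x) μ := by
    refine ⟨(Complex.measurable_ofReal.comp (hψ.mono h𝒜 le_rfl)).aestronglyMeasurable.mul hk,
      (lintegral_mono fun x => ?_).trans_lt hint⟩
    rw [enorm_mul, ← ofReal_norm (ψ x : ℂ), Complex.norm_of_nonneg (hψ₀ x).le]
    exact mul_le_mul_right (hk_le x) _
  exact ⟨ψ, hψ, hψ₀, integrable_mul hf.1 fun x => le_self_add,
    integrable_mul hg.1 fun x => le_add_self⟩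

theorem measurable_mul {c f : X → ℂ} (hc : Measurable[𝒜] c) (hf : Conditionable 𝒜 μ f) :
    Conditionable 𝒜 μ fun x => c x * f x := by
  refine ⟨(hc.mono h𝒜 le_rfl).aestronglyMeasurable.mul hf.1, ?_⟩
  simp only [enorm_mul]
  filter_upwards [condLExp_mul h𝒜 (measurable_enorm.comp hc) hf.1.enorm, hf.2] with x hx hfx
  exact hx.trans_lt (ENNReal.mul_lt_top enorm_lt_top hfx)

end Conditionable

theorem condE_eq_inv_mul_condExp {ψ : X → ℝ} {f : X → ℂ} (hψ : Measurable[𝒜] ψ)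
    (hψ₀ : ∀ x, 0 < ψ x) (hf : AEStronglyMeasurable f μ) (hψf : Integrable (fun x => ψ x * f x) μ) :
    condE 𝒜 μ f =ᵐ[μ] fun x => (ψ x : ℂ)⁻¹ * μ[fun x => ψ x * f x | 𝒜] x := by
  filter_upwards [condE_mul_of_nonneg h𝒜 hψ (fun x => (hψ₀ x).le) hf,
    condE_of_integrable (𝒜 := 𝒜) hψf] with x hmul hint
  have hψx : (ψ x : ℂ) ≠ 0 := by exact_mod_cast (hψ₀ x).ne'
  rw [← hint, hmul, inv_mul_cancel_left₀ hψx]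

theorem condE_add {f g : X → ℂ} (hf : Conditionable 𝒜 μ f) (hg : Conditionable 𝒜 μ g) :
    condE 𝒜 μ (f + g) =ᵐ[μ] condE 𝒜 μ f + condE 𝒜 μ g := by
  obtain ⟨ψ, hψ, hψ₀, hψf, hψg⟩ := hf.exists_pos_integrable_mul h𝒜 hg
  have hdistrib : (fun x => (ψ x : ℂ) * (f x + g x))
      = (fun x => ψ x * f x) + fun x => ψ x * g x := funext fun x => mul_add _ _ _
  have hψadd : Integrable (fun x => (ψ x : ℂ) * (f x + g x)) μ := hdistrib ▸ hψf.add hψg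
  filter_upwards [condE_eq_inv_mul_condExp h𝒜 hψ hψ₀ hf.1 hψf,
    condE_eq_inv_mul_condExp h𝒜 hψ hψ₀ hg.1 hψg,
    condE_eq_inv_mul_condExp h𝒜 hψ hψ₀ (hf.1.add hg.1) hψadd, condExp_add hψf hψg 𝒜]
    with x hfx hgx haddx hadd
  rw [haddx, Pi.add_apply, hfx, hgx]
  simp only [Pi.add_apply]
  rw [hdistrib, hadd, Pi.add_apply, mul_add]

theorem condE_mul {c f : X → ℂ} (hc : Measurable[𝒜] c) (hf : Conditionable 𝒜 μ f) :
    condE 𝒜 μ (fun x => c x * f x) =ᵐ[μ] fun x => c x * condE 𝒜 μ f x := by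
  have hcf := hf.measurable_mul h𝒜 hc
  obtain ⟨ψ, hψ, hψ₀, hψf, hψcf⟩ := hf.exists_pos_integrable_mul h𝒜 hcf
  have hcomm : (fun x => (ψ x : ℂ) * (c x * f x)) = fun x => c x * (ψ x * f x) :=
    funext fun x => mul_left_comm _ _ _
  filter_upwards [condE_eq_inv_mul_condExp h𝒜 hψ hψ₀ hf.1 hψf,
    condE_eq_inv_mul_condExp h𝒜 hψ hψ₀ hcf.1 hψcf,
    condExp_bilin_of_stronglyMeasurable_left (m := 𝒜) (ContinuousLinearMap.mul ℝ ℂ)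
      hc.stronglyMeasurable (hcomm ▸ hψcf) hψf] with x hfx hcfx hpull
  simp only [ContinuousLinearMap.mul_apply'] at hpull
  rw [hcfx, hfx, hcomm, hpull, mul_left_comm]

theorem integral_mul_condE {c f : X → ℂ} (hc : Measurable[𝒜] c) (hf : Conditionable 𝒜 μ f)
    (hint : Integrable (fun x => c x * f x) μ) :
    ∫ x, c x * condE 𝒜 μ f x ∂μ = ∫ x, c x * f x ∂μ := by
  rw [← integral_condExp h𝒜 (f := fun x => c x * f x)]
  exact integral_congr_ae ((condE_mul h𝒜 hc hf).symm.trans (condE_of_integrable hint))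

theorem ae_condE_eq_zero_of_ae_eq_zero {f : X → ℂ} (hf : Conditionable 𝒜 μ f) {s : Set X}
    (hs : MeasurableSet[𝒜] s) (hfs : ∀ᵐ x ∂μ, x ∈ s → f x = 0) :
    ∀ᵐ x ∂μ, x ∈ s → condE 𝒜 μ f x = 0 := by
  have hind : Measurable[𝒜] (s.indicator fun _ => (1 : ℂ)) := measurable_const.indicator hs
  have hzero : (fun x => s.indicator (fun _ => (1 : ℂ)) x * f x) =ᵐ[μ] fun x => 0 * f x := by
    filter_upwards [hfs] with x hx
    by_cases hxs : x ∈ s <;> simp [hxs, hx]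
  filter_upwards [condE_mul h𝒜 hind hf, condE_congr (𝒜 := 𝒜) hzero,
    condE_mul h𝒜 (c := 0) measurable_const hf] with x hmul hcongr hmul_zero hxs
  simp only [Pi.zero_apply] at hmul_zero
  rw [hcongr, hmul_zero, Set.indicator_of_mem hxs, zero_mul, one_mul] at hmul
  exact hmul.symm

theorem lintegral_enorm_mul_sq {c f : X → ℂ} (hc : Measurable[𝒜] c)
    (hf : AEStronglyMeasurable f μ) :
    ∫⁻ x, ‖c x * f x‖ₑ ^ 2 ∂μ = ∫⁻ x, ‖c x‖ₑ ^ 2 * condSq 𝒜 μ f x ∂μ := by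
  simp only [enorm_mul, mul_pow]
  exact (lintegral_mul_condLExp h𝒜 ((measurable_enorm.comp hc).pow_const 2)
    (hf.enorm.pow_const 2)).symm

/-- Take `h = √ψ ū` with a weight `ψ` making it square integrable; then `E(uh) = √ψ E(|u|²)`. -/
theorem exists_Lp_condE_mul_ne_zero {u : X → ℂ} (hu : AEStronglyMeasurable u μ)
    (hu_fin : ∀ᵐ x ∂μ, condSq 𝒜 μ u x < ∞) :
    ∃ h : Lp ℂ 2 μ, ∀ᵐ x ∂μ, u x ≠ 0 → condE 𝒜 μ (fun y => u y * h y) x ≠ 0 := by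
  obtain ⟨ψ, hψ, hψ₀, hint⟩ :=
    exists_pos_lintegral_mul_lt_top h𝒜 (hu.enorm.pow_const 2) hu_fin
  have hsqrt : Measurable[𝒜] fun x => √(ψ x) := hψ.sqrt
  have hmem : MemLp (fun x => (√(ψ x) : ℂ) * conj (u x)) 2 μ := by
    have hmeas : AEStronglyMeasurable (fun x => (√(ψ x) : ℂ) * conj (u x)) μ :=
      (Complex.measurable_ofReal.comp (hsqrt.mono h𝒜 le_rfl)).aestronglyMeasurable.mul
        (Complex.continuous_conj.comp_aestronglyMeasurable hu)
    refine (memLp_two_iff_lintegral_lt_top hmeas).2 ?_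
    convert hint using 3 with x
    rw [← ofReal_norm_sq, norm_mul, mul_pow, Complex.norm_of_nonneg (Real.sqrt_nonneg _),
      Real.sq_sqrt (hψ₀ x).le, RCLike.norm_conj, ENNReal.ofReal_mul (hψ₀ x).le, ofReal_norm_sq]
  have hprod : (fun y => u y * hmem.toLp _ y) =ᵐ[μ] fun y => √(ψ y) * ((‖u y‖ ^ 2 : ℝ) : ℂ) := by
    filter_upwards [hmem.coeFn_toLp] with y hy
    rw [hy, mul_left_comm, RCLike.mul_conj]
    simp
  refine ⟨hmem.toLp _, ?_⟩
  filter_upwards [condE_congr (𝒜 := 𝒜) hprod,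
    condE_mul_of_nonneg h𝒜 hsqrt (fun x => Real.sqrt_nonneg _) (conditionable_norm_sq hu hu_fin).1,
    hu_fin, ae_eq_zero_of_condLExp_eq_zero h𝒜 (hu.enorm.pow_const 2)]
    with x hcongr hmul hfin_x hzero hux
  rw [hcongr, hmul, condE_norm_sq]
  have hsq : condSq 𝒜 μ u x ≠ 0 := fun h => hux (by simpa using hzero h)
  exact mul_ne_zero (by exact_mod_cast (Real.sqrt_pos.2 (hψ₀ x)).ne')
    (by exact_mod_cast (ENNReal.toReal_pos hsq hfin_x.ne).ne')

end ComplexCondExp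

/-- `T = M_w E M_u` as an operator on `L²`. The multiplier `w` may be any function for which
`w E(uh)` is square integrable for all `h`; `weighted a u h` is the case of the multiplier `√a`. -/
def IsWeightedCondExp {X : Type*} (𝒜 : MeasurableSpace X) {ℱ : MeasurableSpace X}
    (μ : Measure[ℱ] X) (w u : X → ℂ) (T : Lp ℂ 2 μ →L[ℂ] Lp ℂ 2 μ) : Prop :=
  ∀ h : Lp ℂ 2 μ, T h =ᵐ[μ] fun x => w x * condE 𝒜 μ (fun y => u y * h y) x

section Multiplier

open ContinuousLinearMap
open scoped ENNReal ComplexConjugate InnerProductSpace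

variable {X : Type*} {𝒜 ℱ : MeasurableSpace X} {μ : Measure[ℱ] X} {c e u : X → ℂ}
  {V A : Lp ℂ 2 μ →L[ℂ] Lp ℂ 2 μ}

theorem conditionable_mul_Lp (hu : AEStronglyMeasurable u μ)
    (hu_fin : ∀ᵐ x ∂μ, condSq 𝒜 μ u x < ∞) (h : Lp ℂ 2 μ) :
    Conditionable 𝒜 μ fun y => u y * h y :=
  conditionable_mul hu (Lp.aestronglyMeasurable h) hu_fin (condSq_lt_top_of_memLp (Lp.memLp h))

namespace IsWeightedCondExp

theorem memLp (hV : IsWeightedCondExp 𝒜 μ c u V) (h : Lp ℂ 2 μ) :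
    MemLp (fun x => c x * condE 𝒜 μ (fun y => u y * h y) x) 2 μ :=
  (Lp.memLp (V h)).ae_eq (hV h)

theorem norm_apply (hV : IsWeightedCondExp 𝒜 μ c u V) (h : Lp ℂ 2 μ) :
    ‖V h‖ = norm2 μ fun x => c x * condE 𝒜 μ (fun y => u y * h y) x := by
  rw [Lp.norm_def, norm2, eLpNorm_congr_ae (hV h)]

theorem inner_apply_apply (hV : IsWeightedCondExp 𝒜 μ c u V) (g h : Lp ℂ 2 μ) :
    ⟪V g, V h⟫_ℂ = ∫ x, (‖c x‖ ^ 2 : ℝ) * conj (condE 𝒜 μ (fun y => u y * g y) x)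
      * condE 𝒜 μ (fun y => u y * h y) x ∂μ := by
  rw [L2.inner_def]
  refine integral_congr_ae ?_
  filter_upwards [hV g, hV h] with x hg hh
  rw [hg, hh, RCLike.inner_apply, map_mul, Complex.ofReal_pow, ← Complex.mul_conj']
  ring

end IsWeightedCondExp

variable (h𝒜 : 𝒜 ≤ ℱ) [SigmaFinite (μ.trim h𝒜)]

include h𝒜

theorem condE_mul_Lp_add (hu : AEStronglyMeasurable u μ) (hu_fin : ∀ᵐ x ∂μ, condSq 𝒜 μ u x < ∞)
    (h h' : Lp ℂ 2 μ) :
    condE 𝒜 μ (fun y => u y * (h + h' : Lp ℂ 2 μ) y) =ᵐ[μ] fun x =>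
      condE 𝒜 μ (fun y => u y * h y) x + condE 𝒜 μ (fun y => u y * h' y) x := by
  refine (condE_congr ?_).trans (condE_add h𝒜 (conditionable_mul_Lp hu hu_fin h)
    (conditionable_mul_Lp hu hu_fin h'))
  filter_upwards [Lp.coeFn_add h h'] with y hy
  rw [hy]
  exact mul_add _ _ _

theorem condE_mul_Lp_smul (hu : AEStronglyMeasurable u μ) (hu_fin : ∀ᵐ x ∂μ, condSq 𝒜 μ u x < ∞)
    (a : ℂ) (h : Lp ℂ 2 μ) :
    condE 𝒜 μ (fun y => u y * (a • h : Lp ℂ 2 μ) y) =ᵐ[μ] fun x =>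
      a * condE 𝒜 μ (fun y => u y * h y) x := by
  refine (condE_congr ?_).trans
    (condE_mul h𝒜 (c := fun _ => a) measurable_const (conditionable_mul_Lp hu hu_fin h))
  filter_upwards [Lp.coeFn_smul a h] with y hy
  rw [hy]
  exact mul_left_comm _ _ _

theorem exists_isWeightedCondExp (hc : AEStronglyMeasurable c μ) (hu : AEStronglyMeasurable u μ)
    (hu_fin : ∀ᵐ x ∂μ, condSq 𝒜 μ u x < ∞) {C : ℝ} (hC : 0 ≤ C)
    (hbound : ∀ h : Lp ℂ 2 μ, ∫⁻ x, ‖c x * condE 𝒜 μ (fun y => u y * h y) x‖ₑ ^ 2 ∂μ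
      ≤ ENNReal.ofReal (C * ‖h‖ ^ 2)) :
    ∃ V : Lp ℂ 2 μ →L[ℂ] Lp ℂ 2 μ, IsWeightedCondExp 𝒜 μ c u V := by
  have hmem (h : Lp ℂ 2 μ) : MemLp (fun x => c x * condE 𝒜 μ (fun y => u y * h y) x) 2 μ :=
    (memLp_two_iff_lintegral_lt_top
      (hc.mul ((measurable_condE _).mono h𝒜 le_rfl).aestronglyMeasurable)).2
      ((hbound h).trans_lt ENNReal.ofReal_lt_top)
  let V₀ : Lp ℂ 2 μ →ₗ[ℂ] Lp ℂ 2 μ :=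
    { toFun := fun h => (hmem h).toLp _
      map_add' := fun h h' => by
        rw [← MemLp.toLp_add]
        refine MemLp.toLp_congr _ _ ?_
        filter_upwards [condE_mul_Lp_add h𝒜 hu hu_fin h h'] with x hx
        rw [hx]
        exact mul_add _ _ _
      map_smul' := fun a h => by
        rw [RingHom.id_apply, ← MemLp.toLp_const_smul]
        refine MemLp.toLp_congr _ _ ?_
        filter_upwards [condE_mul_Lp_smul h𝒜 hu hu_fin a h] with x hx
        rw [hx]
        exact mul_left_comm _ _ _ }
  have hV₀ (h : Lp ℂ 2 μ) : V₀ h =ᵐ[μ] fun x => c x * condE 𝒜 μ (fun y => u y * h y) x :=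
    (hmem h).coeFn_toLp
  have norm_sq_le (h : Lp ℂ 2 μ) : ‖V₀ h‖ ^ 2 ≤ C * ‖h‖ ^ 2 := by
    rw [← ENNReal.ofReal_le_ofReal_iff (by positivity), ofReal_norm_sq_eq_lintegral]
    exact (lintegral_congr_ae ((hV₀ h).fun_comp fun z => ‖z‖ₑ ^ 2)).trans_le (hbound h)
  refine ⟨V₀.mkContinuous (√C) fun h => ?_, hV₀⟩
  refine le_of_sq_le_sq ?_ (by positivity)
  rw [mul_pow, Real.sq_sqrt hC]
  exact norm_sq_le h

namespace IsWeightedCondExp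

theorem memLp_sq_mul_conj (he : Measurable[𝒜] e) (hu : AEStronglyMeasurable u μ)
    (hA : IsWeightedCondExp 𝒜 μ e u A) (heu : ∀ᵐ x ∂μ, ‖e x‖ₑ ^ 2 * condSq 𝒜 μ u x ≤ 1)
    (g : Lp ℂ 2 μ) :
    MemLp (fun x => (‖e x‖ ^ 2 : ℝ) * condE 𝒜 μ (fun y => u y * g y) x * conj (u x)) 2 μ := by
  have hconj : AEStronglyMeasurable (fun x => conj (u x)) μ :=
    Complex.continuous_conj.comp_aestronglyMeasurable hu
  have hk : Measurable[𝒜] fun x => ((‖e x‖ ^ 2 : ℝ) : ℂ) * condE 𝒜 μ (fun y => u y * g y) x :=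
    (Complex.measurable_ofReal.comp ((measurable_norm.comp he).pow_const 2)).mul
      (measurable_condE _)
  have hcondSq : condSq 𝒜 μ (fun x => conj (u x)) = condSq 𝒜 μ u := by
    simp only [condSq, RCLike.enorm_conj]
  refine (memLp_two_iff_lintegral_lt_top
    ((hk.mono h𝒜 le_rfl).aestronglyMeasurable.mul hconj)).2 ?_
  change ∫⁻ x, ‖(‖e x‖ ^ 2 : ℝ) * condE 𝒜 μ (fun y => u y * g y) x * conj (u x)‖ₑ ^ 2 ∂μ < ∞
  rw [lintegral_enorm_mul_sq h𝒜 hk hconj, hcondSq]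
  refine (lintegral_mono_ae ?_).trans_lt
    ((memLp_two_iff_lintegral_lt_top (hA.memLp g).1).1 (hA.memLp g))
  filter_upwards [heu] with x hx
  calc ‖((‖e x‖ ^ 2 : ℝ) : ℂ) * condE 𝒜 μ (fun y => u y * g y) x‖ₑ ^ 2 * condSq 𝒜 μ u x
      = ‖e x * condE 𝒜 μ (fun y => u y * g y) x‖ₑ ^ 2 * (‖e x‖ₑ ^ 2 * condSq 𝒜 μ u x) := by
        have henorm : ‖((‖e x‖ ^ 2 : ℝ) : ℂ)‖ₑ = ‖e x‖ₑ ^ 2 := by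
          rw [← ofReal_norm, Complex.norm_of_nonneg (by positivity), ofReal_norm_sq]
        rw [enorm_mul, henorm, enorm_mul]
        ring
    _ ≤ ‖e x * condE 𝒜 μ (fun y => u y * g y) x‖ₑ ^ 2 := mul_le_of_le_one_right' hx

theorem adjoint_apply_apply (he : Measurable[𝒜] e) (hu : AEStronglyMeasurable u μ)
    (hu_fin : ∀ᵐ x ∂μ, condSq 𝒜 μ u x < ∞) (hA : IsWeightedCondExp 𝒜 μ e u A)
    (heu : ∀ᵐ x ∂μ, ‖e x‖ₑ ^ 2 * condSq 𝒜 μ u x ≤ 1) (g : Lp ℂ 2 μ) :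
    adjoint A (A g) =ᵐ[μ] fun x =>
      (‖e x‖ ^ 2 : ℝ) * condE 𝒜 μ (fun y => u y * g y) x * conj (u x) := by
  have hq := memLp_sq_mul_conj h𝒜 he hu hA heu g
  set q : Lp ℂ 2 μ := hq.toLp _ with hq_def
  suffices adjoint A (A g) = q from this ▸ hq.coeFn_toLp
  refine ext_inner_right ℂ fun h => ?_
  have hk : Measurable[𝒜] fun x =>
      ((‖e x‖ ^ 2 : ℝ) : ℂ) * conj (condE 𝒜 μ (fun y => u y * g y) x) :=
    (Complex.measurable_ofReal.comp ((measurable_norm.comp he).pow_const 2)).mul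
      (Complex.continuous_conj.measurable.comp (measurable_condE _))
  have hinner : (fun x => ⟪q x, h x⟫_ℂ) =ᵐ[μ] fun x =>
      ((‖e x‖ ^ 2 : ℝ) * conj (condE 𝒜 μ (fun y => u y * g y) x)) * (u x * h x) := by
    filter_upwards [hq.coeFn_toLp] with x hx
    rw [hq_def, hx, RCLike.inner_apply, map_mul, map_mul, Complex.conj_conj, Complex.conj_ofReal]
    ring
  rw [adjoint_inner_left, hA.inner_apply_apply, L2.inner_def, integral_congr_ae hinner]
  exact integral_mul_condE h𝒜 hk (conditionable_mul_Lp hu hu_fin h)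
    ((L2.integrable_inner q h).congr hinner)

theorem condE_mul_adjoint_apply_apply (he : Measurable[𝒜] e) (hu : AEStronglyMeasurable u μ)
    (hu_fin : ∀ᵐ x ∂μ, condSq 𝒜 μ u x < ∞) (hA : IsWeightedCondExp 𝒜 μ e u A)
    (heu : ∀ᵐ x ∂μ, ‖e x‖ₑ ^ 2 * condSq 𝒜 μ u x ≤ 1) (g : Lp ℂ 2 μ) :
    condE 𝒜 μ (fun y => u y * adjoint A (A g) y) =ᵐ[μ] fun x =>
      (‖e x‖ ^ 2 * (condSq 𝒜 μ u x).toReal : ℝ) * condE 𝒜 μ (fun y => u y * g y) x := by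
  have hk : Measurable[𝒜] fun x => ((‖e x‖ ^ 2 : ℝ) : ℂ) * condE 𝒜 μ (fun y => u y * g y) x :=
    (Complex.measurable_ofReal.comp ((measurable_norm.comp he).pow_const 2)).mul
      (measurable_condE _)
  have hprod : (fun y => u y * adjoint A (A g) y) =ᵐ[μ] fun y =>
      ((‖e y‖ ^ 2 : ℝ) * condE 𝒜 μ (fun y => u y * g y) y) * ((‖u y‖ ^ 2 : ℝ) : ℂ) := by
    filter_upwards [hA.adjoint_apply_apply h𝒜 he hu hu_fin heu g] with y hy
    rw [hy, Complex.ofReal_pow ‖u y‖, ← Complex.mul_conj']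
    ring
  filter_upwards [condE_congr (𝒜 := 𝒜) hprod,
    condE_mul h𝒜 hk (conditionable_norm_sq hu hu_fin)] with x hcongr hpull
  rw [hcongr, hpull, condE_norm_sq]
  push_cast
  ring

/-- Since `E(u(1 - A*A)h) = (1 - |e|² E(|u|²)) E(uh)`, the hypothesis on `c` and `e` gives
`V*V(1 - A*A) = A*A`. -/
theorem one_add_mul_one_sub_eq_one (he : Measurable[𝒜] e)
    (hu : AEStronglyMeasurable u μ) (hu_fin : ∀ᵐ x ∂μ, condSq 𝒜 μ u x < ∞)
    (hV : IsWeightedCondExp 𝒜 μ c u V) (hA : IsWeightedCondExp 𝒜 μ e u A)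
    (hce : ∀ᵐ x ∂μ, (1 - ‖e x‖ ^ 2 * (condSq 𝒜 μ u x).toReal) * ‖c x‖ ^ 2 = ‖e x‖ ^ 2) :
    (1 + adjoint V * V) * (1 - adjoint A * A) = 1 := by
  have heu : ∀ᵐ x ∂μ, ‖e x‖ₑ ^ 2 * condSq 𝒜 μ u x ≤ 1 := by
    filter_upwards [hce, hu_fin] with x hx hfin
    rw [← ENNReal.ofReal_toReal hfin.ne, ← ofReal_norm_sq, ← ENNReal.ofReal_mul (by positivity),
      ENNReal.ofReal_le_one]
    by_contra! hlt
    have he_zero : ‖e x‖ ^ 2 = 0 := le_antisymm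
      (hx ▸ mul_nonpos_of_nonpos_of_nonneg (by linarith) (sq_nonneg _)) (sq_nonneg _)
    rw [he_zero, zero_mul] at hlt
    exact zero_lt_one.not_gt hlt
  have hsub (g : Lp ℂ 2 μ) : condE 𝒜 μ (fun y => u y * (g - adjoint A (A g) : Lp ℂ 2 μ) y) =ᵐ[μ]
      fun x => (1 - ‖e x‖ ^ 2 * (condSq 𝒜 μ u x).toReal : ℝ)
        * condE 𝒜 μ (fun y => u y * g y) x := by
    have hadd := condE_mul_Lp_add h𝒜 hu hu_fin (g - adjoint A (A g)) (adjoint A (A g))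
    rw [sub_add_cancel] at hadd
    filter_upwards [hadd, hA.condE_mul_adjoint_apply_apply h𝒜 he hu hu_fin heu g] with x hx hAx
    push_cast at hAx ⊢
    linear_combination -hx - hAx
  have hVA : adjoint V * V * (1 - adjoint A * A) = adjoint A * A := by
    ext1 g
    refine ext_inner_right ℂ fun h => ?_
    change ⟪adjoint V (V (g - adjoint A (A g))), h⟫_ℂ = ⟪adjoint A (A g), h⟫_ℂ
    rw [adjoint_inner_left, adjoint_inner_left, hV.inner_apply_apply, hA.inner_apply_apply]
    refine integral_congr_ae ?_
    filter_upwards [hsub g, hce] with x hx hcex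
    rw [hx, map_mul, Complex.conj_ofReal, ← mul_assoc, ← Complex.ofReal_mul, mul_comm (‖c x‖ ^ 2),
      hcex]
  rw [add_mul, one_mul, hVA, sub_add_cancel]

end IsWeightedCondExp

end Multiplier

section Weights

open scoped ENNReal

theorem enorm_ofReal_sqrt_mul_sq (a : ℝ) (z : ℂ) :
    ‖(√a : ℂ) * z‖ₑ ^ 2 = ENNReal.ofReal a * ‖z‖ₑ ^ 2 := by
  rw [enorm_mul, mul_pow, ← ofReal_norm_sq, Complex.norm_of_nonneg (Real.sqrt_nonneg a)]
  rcases le_total 0 a with ha | ha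
  · rw [Real.sq_sqrt ha]
  · rw [Real.sqrt_eq_zero_of_nonpos ha, ENNReal.ofReal_of_nonpos ha]
    simp

variable {X : Type*} {𝒜 ℱ : MeasurableSpace X} {μ : Measure[ℱ] X} {w u : X → ℂ} {c : ℝ} {x : X}

theorem measurable_ofReal_sqrt {a : X → ℝ} (ha : Measurable[𝒜] a) :
    Measurable[𝒜] fun x => (√(a x) : ℂ) :=
  Complex.measurable_ofReal.comp (Real.continuous_sqrt.measurable.comp ha)

theorem measurable_v (w u : X → ℂ) (c : ℝ) : Measurable[𝒜] (v 𝒜 μ w u c) :=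
  ((measurable_condSq w).ennreal_toReal.const_mul _).div (measurable_const.sub
    (((measurable_norm.comp (measurable_condE fun y => u y * w y)).pow_const 2).const_mul _))

theorem measurable_α (w u : X → ℂ) (c : ℝ) : Measurable[𝒜] (α 𝒜 μ w u c) :=
  (measurable_v w u c).div
    (measurable_const.add ((measurable_v w u c).mul (measurable_condSq u).ennreal_toReal))

theorem v_nonneg (hx : c ^ 2 * ‖condE 𝒜 μ (fun y => u y * w y) x‖ ^ 2 < 1) :
    0 ≤ v 𝒜 μ w u c x :=
  div_nonneg (by positivity) (sub_nonneg.2 hx.le)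

theorem α_nonneg (hv : 0 ≤ v 𝒜 μ w u c x) : 0 ≤ α 𝒜 μ w u c x := by
  unfold α
  positivity

theorem α_le_v (hv : 0 ≤ v 𝒜 μ w u c x) : α 𝒜 μ w u c x ≤ v 𝒜 μ w u c x :=
  div_le_self hv (le_add_of_nonneg_right (by positivity))

theorem one_sub_α_mul_mul_v (hv : 0 ≤ v 𝒜 μ w u c x) :
    (1 - α 𝒜 μ w u c x * (condSq 𝒜 μ u x).toReal) * v 𝒜 μ w u c x = α 𝒜 μ w u c x := by
  have hpos : 0 < 1 + v 𝒜 μ w u c x * (condSq 𝒜 μ u x).toReal := by positivity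
  rw [α, div_mul_eq_mul_div, one_sub_div hpos.ne', add_sub_cancel_right, one_div_mul_eq_div]

end Weights

section Powers

open ContinuousLinearMap
open scoped ENNReal InnerProductSpace

variable {X : Type*} {𝒜 ℱ : MeasurableSpace X} {μ : Measure[ℱ] X} {w u : X → ℂ}
  {T : Lp ℂ 2 μ →L[ℂ] Lp ℂ 2 μ} (h𝒜 : 𝒜 ≤ ℱ) [SigmaFinite (μ.trim h𝒜)]

namespace IsWeightedCondExp

include h𝒜

theorem ae_eq_zero_of_condSq_eq_top (hT : IsWeightedCondExp 𝒜 μ w u T)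
    (hw : AEStronglyMeasurable w μ) (hu : AEStronglyMeasurable u μ)
    (hu_fin : ∀ᵐ x ∂μ, condSq 𝒜 μ u x < ∞) : ∀ᵐ x ∂μ, condSq 𝒜 μ w x = ∞ → u x = 0 := by
  obtain ⟨h, hh⟩ := exists_Lp_condE_mul_ne_zero h𝒜 hu hu_fin
  have hE : Measurable[𝒜] (condE 𝒜 μ fun y => u y * h y) := measurable_condE _
  have hfin : ∫⁻ x, ‖condE 𝒜 μ (fun y => u y * h y) x‖ₑ ^ 2 * condSq 𝒜 μ w x ∂μ < ∞ := by
    rw [← lintegral_enorm_mul_sq h𝒜 hE hw]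
    simp only [mul_comm _ (w _)]
    exact (memLp_two_iff_lintegral_lt_top (hT.memLp h).1).1 (hT.memLp h)
  have hmeas : Measurable fun x =>
      ‖condE 𝒜 μ (fun y => u y * h y) x‖ₑ ^ 2 * condSq 𝒜 μ w x :=
    ((hE.mono h𝒜 le_rfl).enorm.pow_const 2).mul ((measurable_condSq w).mono h𝒜 le_rfl)
  filter_upwards [ae_lt_top hmeas hfin.ne, hh] with x hlt hx htop
  by_contra hux
  rw [htop, ENNReal.mul_top (by simpa using hx hux)] at hlt
  exact hlt.false

theorem conditionable_symbol (hT : IsWeightedCondExp 𝒜 μ w u T)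
    (hw : AEStronglyMeasurable w μ) (hu : AEStronglyMeasurable u μ)
    (hu_fin : ∀ᵐ x ∂μ, condSq 𝒜 μ u x < ∞) : Conditionable 𝒜 μ fun y => u y * w y := by
  set B : Set X := {x | condSq 𝒜 μ w x < ∞}
  have hB : Measurable[𝒜] (B.indicator fun _ => (1 : ℝ≥0∞)) :=
    measurable_const.indicator (measurable_condSq w measurableSet_Iio)
  have hsq : AEMeasurable ((fun y => ‖u y‖ₑ ^ 2) + fun y => ‖w y‖ₑ ^ 2) μ :=
    (hu.enorm.pow_const 2).add (hw.enorm.pow_const 2)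
  refine .of_enorm_le (hu.mul hw)
    (g := fun x => B.indicator (fun _ => 1) x * ((fun y => ‖u y‖ₑ ^ 2) + fun y => ‖w y‖ₑ ^ 2) x)
    ?_ ?_
  · filter_upwards [hT.ae_eq_zero_of_condSq_eq_top h𝒜 hw hu hu_fin] with x hx
    by_cases hxB : x ∈ B
    · rw [Set.indicator_of_mem hxB, one_mul]
      exact enorm_mul_le_sq_add_sq _ _
    · simp [hx (not_lt_top_iff.1 hxB)]
  · filter_upwards [condLExp_mul h𝒜 hB hsq, hu_fin,
      condLExp_add_left (mΩ := 𝒜) (fun y => ‖w y‖ₑ ^ 2) (hu.enorm.pow_const 2)] with x hmul hux hadd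
    rw [hmul, hadd]
    by_cases hxB : x ∈ B
    · rw [Set.indicator_of_mem hxB, one_mul]
      exact ENNReal.add_lt_top.2 ⟨hux, hxB⟩
    · simp [hxB]

theorem condE_eq_zero_of_condSq_eq_top (hT : IsWeightedCondExp 𝒜 μ w u T)
    (hw : AEStronglyMeasurable w μ) (hu : AEStronglyMeasurable u μ)
    (hu_fin : ∀ᵐ x ∂μ, condSq 𝒜 μ u x < ∞) (h : Lp ℂ 2 μ) :
    ∀ᵐ x ∂μ, condSq 𝒜 μ w x = ∞ → condE 𝒜 μ (fun y => u y * h y) x = 0 := by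
  refine ae_condE_eq_zero_of_ae_eq_zero h𝒜 (conditionable_mul_Lp hu hu_fin h)
    (s := {x | condSq 𝒜 μ w x = ∞}) (measurable_condSq w (measurableSet_singleton ∞)) ?_
  filter_upwards [hT.ae_eq_zero_of_condSq_eq_top h𝒜 hw hu hu_fin] with x hx hxtop
  rw [hx hxtop, zero_mul]

theorem pow_succ_apply (hT : IsWeightedCondExp 𝒜 μ w u T)
    (huw : Conditionable 𝒜 μ fun y => u y * w y) (h : Lp ℂ 2 μ) (n : ℕ) :
    (T ^ (n + 1)) h =ᵐ[μ] fun x =>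
      condE 𝒜 μ (fun y => u y * w y) x ^ n * condE 𝒜 μ (fun y => u y * h y) x * w x := by
  induction n with
  | zero =>
    filter_upwards [hT h] with x hx
    rw [zero_add, pow_one, hx, pow_zero, one_mul, mul_comm]
  | succ n ih =>
    have hk : Measurable[𝒜] fun x =>
        condE 𝒜 μ (fun y => u y * w y) x ^ n * condE 𝒜 μ (fun y => u y * h y) x :=
      ((measurable_condE _).pow_const n).mul (measurable_condE _)
    have hprod : (fun y => u y * (T ^ (n + 1)) h y) =ᵐ[μ] fun y =>
        (condE 𝒜 μ (fun y => u y * w y) y ^ n * condE 𝒜 μ (fun y => u y * h y) y)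
          * (u y * w y) := by
      filter_upwards [ih] with y hy
      rw [hy]
      ring
    rw [pow_succ' T (n + 1)]
    filter_upwards [hT ((T ^ (n + 1)) h), condE_congr (𝒜 := 𝒜) hprod, condE_mul h𝒜 hk huw]
      with x hTx hcongr hpull
    rw [mul_apply_eq_comp, hTx, hcongr, hpull]
    ring

theorem tsum_norm_pow_succ_apply_sq (hT : IsWeightedCondExp 𝒜 μ w u T)
    (hw : AEStronglyMeasurable w μ) (huw : Conditionable 𝒜 μ fun y => u y * w y) (c : ℝ)
    (h : Lp ℂ 2 μ) :
    ∑' n : ℕ, ENNReal.ofReal (c ^ (2 * (n + 1)) * ‖(T ^ (n + 1)) h‖ ^ 2)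
      = ∫⁻ x, ENNReal.ofReal (c ^ 2)
          * (1 - ENNReal.ofReal (c ^ 2 * ‖condE 𝒜 μ (fun y => u y * w y) x‖ ^ 2))⁻¹
          * (‖condE 𝒜 μ (fun y => u y * h y) x‖ₑ ^ 2 * condSq 𝒜 μ w x) ∂μ := by
  have hE (f : X → ℂ) : Measurable (condE 𝒜 μ f) := (measurable_condE f).mono h𝒜 le_rfl
  have hw₂ : Measurable (condSq 𝒜 μ w) := (measurable_condSq w).mono h𝒜 le_rfl
  have hterm (n : ℕ) : ENNReal.ofReal (c ^ (2 * (n + 1)) * ‖(T ^ (n + 1)) h‖ ^ 2)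
      = ∫⁻ x, ENNReal.ofReal (c ^ 2)
          * ENNReal.ofReal (c ^ 2 * ‖condE 𝒜 μ (fun y => u y * w y) x‖ ^ 2) ^ n
          * (‖condE 𝒜 μ (fun y => u y * h y) x‖ₑ ^ 2 * condSq 𝒜 μ w x) ∂μ := by
    have hk : Measurable[𝒜] fun x =>
        condE 𝒜 μ (fun y => u y * w y) x ^ n * condE 𝒜 μ (fun y => u y * h y) x :=
      ((measurable_condE _).pow_const n).mul (measurable_condE _)
    have hpow : ∫⁻ x, ‖(T ^ (n + 1)) h x‖ₑ ^ 2 ∂μ = ∫⁻ x, ‖condE 𝒜 μ (fun y => u y * w y) x ^ n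
        * condE 𝒜 μ (fun y => u y * h y) x * w x‖ₑ ^ 2 ∂μ :=
      lintegral_congr_ae ((hT.pow_succ_apply h𝒜 huw h n).fun_comp fun z => ‖z‖ₑ ^ 2)
    rw [ENNReal.ofReal_mul (by rw [pow_mul]; positivity), ofReal_norm_sq_eq_lintegral, hpow,
      lintegral_enorm_mul_sq h𝒜 hk hw, ← lintegral_const_mul' _ _ ENNReal.ofReal_ne_top]
    refine lintegral_congr fun x => ?_
    rw [ENNReal.ofReal_mul (by positivity), ofReal_norm_sq, pow_mul,
      ENNReal.ofReal_pow (by positivity), enorm_mul, enorm_pow]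
    ring
  simp only [hterm, ← ENNReal.tsum_geometric, ← ENNReal.tsum_mul_left, ← ENNReal.tsum_mul_right]
  refine (lintegral_tsum fun n => Measurable.aemeasurable ?_).symm
  exact (((((hE _).norm.pow_const 2).const_mul _).ennreal_ofReal.pow_const n).const_mul _).mul
    (((hE _).enorm.pow_const 2).mul hw₂)

theorem sq_mul_norm_condE_sq_lt_one (hT : IsWeightedCondExp 𝒜 μ w u T)
    (hw : AEStronglyMeasurable w μ) (hu : AEStronglyMeasurable u μ)
    (hu_fin : ∀ᵐ x ∂μ, condSq 𝒜 μ u x < ∞) {c : ℝ}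
    (hsum : ∀ h, Summable fun n : ℕ => c ^ (2 * (n + 1)) * ‖(T ^ (n + 1)) h‖ ^ 2) :
    ∀ᵐ x ∂μ, c ^ 2 * ‖condE 𝒜 μ (fun y => u y * w y) x‖ ^ 2 < 1 := by
  have huw := hT.conditionable_symbol h𝒜 hw hu hu_fin
  obtain ⟨h, hh⟩ := exists_Lp_condE_mul_ne_zero h𝒜 hu hu_fin
  set B : Set X := {x | 1 ≤ c ^ 2 * ‖condE 𝒜 μ (fun y => u y * w y) x‖ ^ 2}
  have hE (f : X → ℂ) : Measurable (condE 𝒜 μ f) := (measurable_condE f).mono h𝒜 le_rfl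
  have hB : MeasurableSet[𝒜] B := measurableSet_le measurable_const
    (((measurable_norm.comp (measurable_condE _)).pow_const 2).const_mul _)
  have hfin := (hsum h).tsum_ofReal_ne_top
  rw [hT.tsum_norm_pow_succ_apply_sq h𝒜 hw huw] at hfin
  have hmeas : Measurable fun x => ENNReal.ofReal (c ^ 2)
      * (1 - ENNReal.ofReal (c ^ 2 * ‖condE 𝒜 μ (fun y => u y * w y) x‖ ^ 2))⁻¹
      * (‖condE 𝒜 μ (fun y => u y * h y) x‖ₑ ^ 2 * condSq 𝒜 μ w x) :=
    (((((hE _).norm.pow_const 2).const_mul _).ennreal_ofReal.const_sub 1).inv.const_mul _).mul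
      (((hE _).enorm.pow_const 2).mul ((measurable_condSq w).mono h𝒜 le_rfl))
  have huw_zero : ∀ᵐ x ∂μ, x ∈ B → u x * w x = 0 := by
    filter_upwards [ae_lt_top hmeas hfin, hh,
      ae_eq_zero_of_condLExp_eq_zero h𝒜 (hw.enorm.pow_const 2)] with x hlt hx hwx hxB
    have hc : 0 < c ^ 2 := pos_of_mul_pos_left (zero_lt_one.trans_le hxB) (sq_nonneg _)
    rw [tsub_eq_zero_of_le (ENNReal.one_le_ofReal.2 hxB), ENNReal.inv_zero,
      ENNReal.mul_top (ENNReal.ofReal_pos.2 hc).ne'] at hlt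
    have hprod : ‖condE 𝒜 μ (fun y => u y * h y) x‖ₑ ^ 2 * condSq 𝒜 μ w x = 0 := by
      by_contra hne
      exact (ENNReal.top_mul hne ▸ hlt).false
    rcases mul_eq_zero.1 hprod with hEh | hEw
    · rw [not_imp_comm.1 hx (by simpa using hEh), zero_mul]
    · rw [show w x = 0 by simpa using hwx hEw, mul_zero]
  filter_upwards [ae_condE_eq_zero_of_ae_eq_zero h𝒜 huw hB huw_zero] with x hx
  by_contra! hxB
  have hone : (1 : ℝ) ≤ c ^ 2 * ‖condE 𝒜 μ (fun y => u y * w y) x‖ ^ 2 := hxB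
  rw [hx hxB] at hone
  norm_num at hone

theorem lintegral_enorm_weighted_v_sq (hT : IsWeightedCondExp 𝒜 μ w u T)
    (hw : AEStronglyMeasurable w μ) (hu : AEStronglyMeasurable u μ)
    (hu_fin : ∀ᵐ x ∂μ, condSq 𝒜 μ u x < ∞) {c : ℝ}
    (hlt : ∀ᵐ x ∂μ, c ^ 2 * ‖condE 𝒜 μ (fun y => u y * w y) x‖ ^ 2 < 1) (h : Lp ℂ 2 μ) :
    ∫⁻ x, ‖weighted 𝒜 μ (v 𝒜 μ w u c) u h x‖ₑ ^ 2 ∂μ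
      = ∑' n : ℕ, ENNReal.ofReal (c ^ (2 * (n + 1)) * ‖(T ^ (n + 1)) h‖ ^ 2) := by
  rw [hT.tsum_norm_pow_succ_apply_sq h𝒜 hw (hT.conditionable_symbol h𝒜 hw hu hu_fin)]
  refine lintegral_congr_ae ?_
  filter_upwards [hlt, hT.condE_eq_zero_of_condSq_eq_top h𝒜 hw hu hu_fin h] with x hx htop
  rw [weighted, enorm_ofReal_sqrt_mul_sq]
  by_cases hwx : condSq 𝒜 μ w x = ∞
  · simp [htop hwx]
  · rw [v, ENNReal.ofReal_div_of_pos (sub_pos.2 hx), ENNReal.ofReal_mul (sq_nonneg c),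
      ENNReal.ofReal_toReal hwx, ENNReal.ofReal_sub _ (by positivity), ENNReal.ofReal_one,
      div_eq_mul_inv]
    ring

theorem sq_mul_norm_condE_sq_lt_one_of_spectralRadius (hT : IsWeightedCondExp 𝒜 μ w u T)
    (hw : AEStronglyMeasurable w μ) (hu : AEStronglyMeasurable u μ)
    (hu_fin : ∀ᵐ x ∂μ, condSq 𝒜 μ u x < ∞) {c : ℝ} (hc₀ : 0 < c)
    (hc : c * (spectralRadius ℂ T).toReal < 1) :
    ∀ᵐ x ∂μ, c ^ 2 * ‖condE 𝒜 μ (fun y => u y * w y) x‖ ^ 2 < 1 :=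
  hT.sq_mul_norm_condE_sq_lt_one h𝒜 hw hu hu_fin fun h =>
    (hasSum_norm_pow_succ_apply_sq T hc₀ hc h).summable

theorem lintegral_enorm_weighted_v_sq_eq_re_inner (hT : IsWeightedCondExp 𝒜 μ w u T)
    (hw : AEStronglyMeasurable w μ) (hu : AEStronglyMeasurable u μ)
    (hu_fin : ∀ᵐ x ∂μ, condSq 𝒜 μ u x < ∞) {c : ℝ} (hc₀ : 0 < c)
    (hc : c * (spectralRadius ℂ T).toReal < 1) (h : Lp ℂ 2 μ) :
    ∫⁻ x, ‖weighted 𝒜 μ (v 𝒜 μ w u c) u h x‖ₑ ^ 2 ∂μ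
      = ENNReal.ofReal (RCLike.re ⟪h, (powerGram T c - 1) h⟫_ℂ) := by
  have hsum := hasSum_norm_pow_succ_apply_sq T hc₀ hc h
  rw [hT.lintegral_enorm_weighted_v_sq h𝒜 hw hu hu_fin
      (hT.sq_mul_norm_condE_sq_lt_one_of_spectralRadius h𝒜 hw hu hu_fin hc₀ hc),
    ← hsum.tsum_eq, ENNReal.ofReal_tsum_of_nonneg (fun n => by positivity) hsum.summable]

theorem lintegral_enorm_weighted_v_sq_le (hT : IsWeightedCondExp 𝒜 μ w u T)
    (hw : AEStronglyMeasurable w μ) (hu : AEStronglyMeasurable u μ)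
    (hu_fin : ∀ᵐ x ∂μ, condSq 𝒜 μ u x < ∞) {c : ℝ} (hc₀ : 0 < c)
    (hc : c * (spectralRadius ℂ T).toReal < 1) (h : Lp ℂ 2 μ) :
    ∫⁻ x, ‖weighted 𝒜 μ (v 𝒜 μ w u c) u h x‖ₑ ^ 2 ∂μ
      ≤ ENNReal.ofReal (‖powerGram T c - 1‖ * ‖h‖ ^ 2) := by
  rw [hT.lintegral_enorm_weighted_v_sq_eq_re_inner h𝒜 hw hu hu_fin hc₀ hc]
  refine ENNReal.ofReal_le_ofReal ?_
  calc RCLike.re ⟪h, (powerGram T c - 1) h⟫_ℂ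
      ≤ ‖h‖ * ‖(powerGram T c - 1) h‖ := re_inner_le_norm _ _
    _ ≤ ‖h‖ * (‖powerGram T c - 1‖ * ‖h‖) := by gcongr; exact le_opNorm _ _
    _ = ‖powerGram T c - 1‖ * ‖h‖ ^ 2 := by ring

theorem exists_isWeightedCondExp_sqrt_v (hT : IsWeightedCondExp 𝒜 μ w u T)
    (hw : AEStronglyMeasurable w μ) (hu : AEStronglyMeasurable u μ)
    (hu_fin : ∀ᵐ x ∂μ, condSq 𝒜 μ u x < ∞) {c : ℝ} (hc₀ : 0 < c)
    (hc : c * (spectralRadius ℂ T).toReal < 1) :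
    ∃ V : Lp ℂ 2 μ →L[ℂ] Lp ℂ 2 μ,
      IsWeightedCondExp 𝒜 μ (fun x => (√(v 𝒜 μ w u c x) : ℂ)) u V :=
  exists_isWeightedCondExp h𝒜
    ((measurable_ofReal_sqrt (measurable_v w u c)).mono h𝒜 le_rfl).aestronglyMeasurable hu hu_fin
    (norm_nonneg _) (hT.lintegral_enorm_weighted_v_sq_le h𝒜 hw hu hu_fin hc₀ hc)

theorem exists_isWeightedCondExp_sqrt_α (hT : IsWeightedCondExp 𝒜 μ w u T)
    (hw : AEStronglyMeasurable w μ) (hu : AEStronglyMeasurable u μ)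
    (hu_fin : ∀ᵐ x ∂μ, condSq 𝒜 μ u x < ∞) {c : ℝ} (hc₀ : 0 < c)
    (hc : c * (spectralRadius ℂ T).toReal < 1) :
    ∃ A : Lp ℂ 2 μ →L[ℂ] Lp ℂ 2 μ,
      IsWeightedCondExp 𝒜 μ (fun x => (√(α 𝒜 μ w u c x) : ℂ)) u A := by
  refine exists_isWeightedCondExp h𝒜
    ((measurable_ofReal_sqrt (measurable_α w u c)).mono h𝒜 le_rfl).aestronglyMeasurable hu hu_fin
    (norm_nonneg _) fun h =>
      (lintegral_mono_ae ?_).trans (hT.lintegral_enorm_weighted_v_sq_le h𝒜 hw hu hu_fin hc₀ hc h)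
  filter_upwards [hT.sq_mul_norm_condE_sq_lt_one_of_spectralRadius h𝒜 hw hu hu_fin hc₀ hc]
    with x hx
  rw [weighted, enorm_ofReal_sqrt_mul_sq, enorm_ofReal_sqrt_mul_sq]
  gcongr
  exact α_le_v (v_nonneg hx)

theorem powerGram_eq_one_add_adjoint_mul_self (hT : IsWeightedCondExp 𝒜 μ w u T)
    (hw : AEStronglyMeasurable w μ) (hu : AEStronglyMeasurable u μ)
    (hu_fin : ∀ᵐ x ∂μ, condSq 𝒜 μ u x < ∞) {c : ℝ} (hc₀ : 0 < c)
    (hc : c * (spectralRadius ℂ T).toReal < 1) {V : Lp ℂ 2 μ →L[ℂ] Lp ℂ 2 μ}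
    (hV : IsWeightedCondExp 𝒜 μ (fun x => (√(v 𝒜 μ w u c x) : ℂ)) u V) :
    powerGram T c = 1 + adjoint V * V := by
  have hV_sq (h : Lp ℂ 2 μ) : ‖V h‖ ^ 2 = RCLike.re ⟪h, (powerGram T c - 1) h⟫_ℂ := by
    rw [← ENNReal.ofReal_eq_ofReal_iff (by positivity)
        ((hasSum_norm_pow_succ_apply_sq T hc₀ hc h).nonneg fun n => by positivity),
      ← hT.lintegral_enorm_weighted_v_sq_eq_re_inner h𝒜 hw hu hu_fin hc₀ hc,
      ofReal_norm_sq_eq_lintegral]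
    exact lintegral_congr_ae ((hV h).fun_comp fun z => ‖z‖ₑ ^ 2)
  rw [← eq_adjoint_mul_self_of_re_inner ((isSelfAdjoint_powerGram T c).sub (.one _)) hV_sq,
    add_sub_cancel]

theorem one_add_sqrt_v_mul_one_sub_sqrt_α_eq_one (hT : IsWeightedCondExp 𝒜 μ w u T)
    (hw : AEStronglyMeasurable w μ) (hu : AEStronglyMeasurable u μ)
    (hu_fin : ∀ᵐ x ∂μ, condSq 𝒜 μ u x < ∞) {c : ℝ} (hc₀ : 0 < c)
    (hc : c * (spectralRadius ℂ T).toReal < 1) {V A : Lp ℂ 2 μ →L[ℂ] Lp ℂ 2 μ}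
    (hV : IsWeightedCondExp 𝒜 μ (fun x => (√(v 𝒜 μ w u c x) : ℂ)) u V)
    (hA : IsWeightedCondExp 𝒜 μ (fun x => (√(α 𝒜 μ w u c x) : ℂ)) u A) :
    (1 + adjoint V * V) * (1 - adjoint A * A) = 1 := by
  refine hV.one_add_mul_one_sub_eq_one h𝒜 (measurable_ofReal_sqrt (measurable_α w u c)) hu hu_fin
    hA ?_
  filter_upwards [hT.sq_mul_norm_condE_sq_lt_one_of_spectralRadius h𝒜 hw hu hu_fin hc₀ hc]
    with x hx
  have hv := v_nonneg hx
  rw [Complex.norm_of_nonneg (Real.sqrt_nonneg _), Complex.norm_of_nonneg (Real.sqrt_nonneg _),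
    Real.sq_sqrt hv, Real.sq_sqrt (α_nonneg hv), one_sub_α_mul_mul_v hv]

theorem norm_R_mul_rankOne_mul_inverse_sq (hT : IsWeightedCondExp 𝒜 μ w u T)
    (hw : AEStronglyMeasurable w μ) (hu : AEStronglyMeasurable u μ)
    (hu_fin : ∀ᵐ x ∂μ, condSq 𝒜 μ u x < ∞) (m : ℕ+) (f g : Lp ℂ 2 μ) :
    MemLp (weighted 𝒜 μ (v 𝒜 μ w u (d T m)) u f) 2 μ ∧
    MemLp (weighted 𝒜 μ (α 𝒜 μ w u (d T m)) u g) 2 μ ∧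
    ‖R T m * InnerProductSpace.rankOne ℂ f g * Ring.inverse (R T m)‖ ^ 2
      = (‖f‖ ^ 2 + norm2 μ (weighted 𝒜 μ (v 𝒜 μ w u (d T m)) u f) ^ 2)
        * (‖g‖ ^ 2 - norm2 μ (weighted 𝒜 μ (α 𝒜 μ w u (d T m)) u g) ^ 2) := by
  have hd₀ := d_pos T m
  have hd := d_mul_spectralRadius_lt_one T m
  obtain ⟨V, hV⟩ := hT.exists_isWeightedCondExp_sqrt_v h𝒜 hw hu hu_fin hd₀ hd
  obtain ⟨A, hA⟩ := hT.exists_isWeightedCondExp_sqrt_α h𝒜 hw hu hu_fin hd₀ hd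
  refine ⟨hV.memLp f, hA.memLp g, ?_⟩
  rw [norm_R_mul_rankOne_mul_inverse_sq_of_powerGram_eq T m
      (hT.powerGram_eq_one_add_adjoint_mul_self h𝒜 hw hu hu_fin hd₀ hd hV)
      (hT.one_add_sqrt_v_mul_one_sub_sqrt_α_eq_one h𝒜 hw hu hu_fin hd₀ hd hV hA),
    hV.norm_apply, hA.norm_apply]
  rfl

end IsWeightedCondExp

end Powers

theorem bddAbove_range_iff_of_sq_eq_const_add {ι : Type*} {a b : ι → ℝ} {K : ℝ}
    (ha : ∀ i, 0 ≤ a i) (hab : ∀ i, a i ^ 2 = K + b i) :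
    BddAbove (Set.range a) ↔ BddAbove (Set.range b) := by
  simp only [bddAbove_def, Set.forall_mem_range]
  constructor
  · rintro ⟨C, hC⟩
    exact ⟨C ^ 2 - K, fun i => by nlinarith [hab i, pow_le_pow_left₀ (ha i) (hC i) 2]⟩
  · rintro ⟨C, hC⟩
    exact ⟨√(K + C), fun i => Real.le_sqrt_of_sq_le (by linarith [hab i, hC i])⟩

end SpectralRadiusAlgebra

open SpectralRadiusAlgebra in
theorem mainTheorem12_general {X : Type*} {𝒜 ℱ : MeasurableSpace X} (h𝒜 : 𝒜 ≤ ℱ)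
    (μ : Measure[ℱ] X) [SigmaFinite (μ.trim h𝒜)]
    (w u : X → ℂ) (hw : AEStronglyMeasurable w μ) (hu : AEStronglyMeasurable u μ)
    (hu_fin : ∀ᵐ x ∂μ, condSq 𝒜 μ u x < ⊤)
    (T : Lp ℂ 2 μ →L[ℂ] Lp ℂ 2 μ) (hT : IsWeightedCondExp 𝒜 μ w u T) (f g : Lp ℂ 2 μ) :
    (∀ m : ℕ+, MemLp (weighted 𝒜 μ (v 𝒜 μ w u (d T m)) u f) 2 μ ∧
      MemLp (weighted 𝒜 μ (α 𝒜 μ w u (d T m)) u g) 2 μ) ∧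
    (InnerProductSpace.rankOne ℂ f g ∈ algebraB T ↔
      BddAbove (Set.range fun m : ℕ+ =>
        -(norm2 μ (weighted 𝒜 μ (α 𝒜 μ w u (d T m)) u g) ^ 2 * ‖f‖ ^ 2)
          + norm2 μ (weighted 𝒜 μ (v 𝒜 μ w u (d T m)) u f) ^ 2
            * (‖g‖ ^ 2 - norm2 μ (weighted 𝒜 μ (α 𝒜 μ w u (d T m)) u g) ^ 2))) := by
  have hR := fun m => hT.norm_R_mul_rankOne_mul_inverse_sq h𝒜 hw hu hu_fin m f g
  refine ⟨fun m => ⟨(hR m).1, (hR m).2.1⟩,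
    bddAbove_range_iff_of_sq_eq_const_add (K := ‖f‖ ^ 2 * ‖g‖ ^ 2) (fun m => norm_nonneg _)
      fun m => ?_⟩
  rw [(hR m).2.2]
  ring

open SpectralRadiusAlgebra in
theorem mainTheorem12 {X : Type*} {𝒜 ℱ : MeasurableSpace X} (h𝒜 : 𝒜 ≤ ℱ)
    (μ : Measure[ℱ] X) [SigmaFinite μ] [SigmaFinite (μ.trim h𝒜)]
    (w u : X → ℂ) (hw : Conditionable 𝒜 μ w) (hu : Conditionable 𝒜 μ u)
    (hu_bdd : essSup (condSq 𝒜 μ u) μ < ⊤)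
    (T : Lp ℂ 2 μ →L[ℂ] Lp ℂ 2 μ)
    (hT : ∀ h : Lp ℂ 2 μ, T h =ᵐ[μ] fun x => w x * condE 𝒜 μ (fun y => u y * h y) x)
    (f g : Lp ℂ 2 μ) :
    (∀ m : ℕ+, MemLp (weighted 𝒜 μ (v 𝒜 μ w u (d T m)) u f) 2 μ ∧
      MemLp (weighted 𝒜 μ (α 𝒜 μ w u (d T m)) u g) 2 μ) ∧
    (InnerProductSpace.rankOne ℂ f g ∈ algebraB T ↔
      BddAbove (Set.range fun m : ℕ+ =>
        -(norm2 μ (weighted 𝒜 μ (α 𝒜 μ w u (d T m)) u g) ^ 2 * ‖f‖ ^ 2)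
          + norm2 μ (weighted 𝒜 μ (v 𝒜 μ w u (d T m)) u f) ^ 2
            * (‖g‖ ^ 2 - norm2 μ (weighted 𝒜 μ (α 𝒜 μ w u (d T m)) u g) ^ 2))) :=
  mainTheorem12_general h𝒜 μ w u hw.1 hu.1
    ((ENNReal.ae_le_essSup _).mono fun _ hx => hx.trans_lt hu_bdd) T hT f g
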